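/- Let $A<B$ be real numbers and $W=[A,B]$. An interval in $W$ is a set $I$ with end-points $A\le a<b\le B$ that is open, closed or half-closed; $mI=b-a$ is its length, and $m$ denotes Lebesgue measure. Two intervals are non-overlapping if they have no interval of positive length in common. Let $R$ be a finite union of intervals in $W$. A division of $R$ is a finite set $D$ of pairwise non-overlapping intervals (each of which may or may not contain either of its end-points) the union of whose closures is the closure of $R$; its norm is the greatest length of an interval of $D$. Let $G_1$ be the family of all divisions of all such $R$. Let $g$ be an arbitrary real-valued function of the intervals in $W$. The upper norm-limit of $g$ over $R$ with respect to $G_1$ is $$(N;G_1)\overline{\int}_R g(I)=\inf_{e>0}\ \sup\Big\{\sum_{I\in D}g(I): D\text{ a division of }R\text{ with norm less than }e\Big\}\in[-\infty,+\infty],$$ and the lower norm-limit $(N;G_1)\underline{\int}_R g(I)$ is defined in the same way with $\sup$ and $\inf$ interchanged. If the two are finite and equal, the norm-limit $N(R)$ of $g$ over $R$ is said to exist and is their common value. For a Lebesgue measurable set $E\subseteq W$ the upper and lower density integrals of $g$ over $E$ are $$(D;G_1)\overline{\int}_E g(I)=(N;G_1)\overline{\int}_W \frac{g(I)\,m(E\cap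 I)}{mI},\qquad (D;G_1)\underline{\int}_E g(I)=(N;G_1)\underline{\int}_W \frac{g(I)\,m(E\cap I)}{mI}.$$ Then the upper and lower density integrals $(D;G_1)\overline{\int}_E g(I)$ and $(D;G_1)\underline{\int}_E g(I)$ are finite and equal for every Lebesgue measurable set $E\subseteq W$ if and only if the norm-limit $N(R)$ of $g$ exists for every finite union $R$ of intervals in $W$ and the interval function $I\mapsto N(I)$ is absolutely continuous in $W$, that is, for every $\varepsilon>0$ there is $\delta>0$ such that $\big|\sum_{j=1}^{n} N(I_j)\big|<\varepsilon$ for all finite sets $I_1,\dots,I_n$ of pairwise non-overlapping intervals in $W$ with $\sum_{j=1}^n mI_j<\delta$. -/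

import Mathlib

open MeasureTheory

/-- An interval in the fundamental interval `W = [A, B]`: end-points `A ≤ lo < hi ≤ B` together with
its bracket convention, which says for each end-point whether it is included. The set `S₁` of all
intervals in `W` is the whole type. -/
@[ext]
structure LinInterval (A B : ℝ) where
  lo : ℝ
  hi : ℝ
  leftClosed : Bool
  rightClosed : Bool
  le_lo : A ≤ lo
  lo_lt_hi : lo < hi
  hi_le : hi ≤ B

namespace LinInterval

variable {A B : ℝ}

/-- The points of the interval. -/
def toSet (I : LinInterval A B) : Set ℝ :=
  {x | (I.lo < x ∨ (I.leftClosed = true ∧ x = I.lo)) ∧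
    (x < I.hi ∨ (I.rightClosed = true ∧ x = I.hi))}

/-- The length `mI`. -/
def length (I : LinInterval A B) : ℝ := I.hi - I.lo

/-- Two intervals do not overlap when they have no (nondegenerate) interval in common;
they may share an end-point. -/
def NonOverlapping (I J : LinInterval A B) : Prop := I.hi ≤ J.lo ∨ J.hi ≤ I.lo

end LinInterval

/-- `R` is a finite sum of intervals in `W` (an `I^σ`). -/
def IsISigma (A B : ℝ) (R : Set ℝ) : Prop :=
  ∃ T : Finset (LinInterval A B), R = ⋃ I ∈ T, I.toSet

/-- `D` is a division of `R`: finitely many non-overlapping intervals, each with an arbitrary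
bracket convention, which fill up the closure `R'` of `R`. -/
def IsDivision {A B : ℝ} (R : Set ℝ) (D : Finset (LinInterval A B)) : Prop :=
  (D : Set (LinInterval A B)).Pairwise LinInterval.NonOverlapping ∧
    (⋃ I ∈ D, Set.Icc I.lo I.hi) = closure R

/-- The family `G₁` of all divisions of all finite sums of intervals in `W`. -/
def G1 (A B : ℝ) : Set (Finset (LinInterval A B)) :=
  {D | ∃ R : Set ℝ, IsISigma A B R ∧ IsDivision R D}

/-- The divisions of `R` in the family `G` with norm (greatest length of an interval) less
than `e`. -/
def fineDivisions {A B : ℝ} (G : Set (Finset (LinInterval A B))) (R : Set ℝ) (e : ℝ) :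
    Set (Finset (LinInterval A B)) :=
  {D | D ∈ G ∧ IsDivision R D ∧ ∀ I ∈ D, I.length < e}

/-- The upper norm-limit of `g` over `R` with respect to `G`, an extended real number. -/
noncomputable def upperNormLimit {A B : ℝ} (G : Set (Finset (LinInterval A B))) (R : Set ℝ)
    (g : LinInterval A B → ℝ) : EReal :=
  ⨅ (e : ℝ) (_ : 0 < e), ⨆ D ∈ fineDivisions G R e, ((∑ I ∈ D, g I : ℝ) : EReal)

/-- The lower norm-limit of `g` over `R` with respect to `G`, an extended real number. -/
noncomputable def lowerNormLimit {A B : ℝ} (G : Set (Finset (LinInterval A B))) (R : Set ℝ)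
    (g : LinInterval A B → ℝ) : EReal :=
  ⨆ (e : ℝ) (_ : 0 < e), ⨅ D ∈ fineDivisions G R e, ((∑ I ∈ D, g I : ℝ) : EReal)

/-- The norm-limit of `g` over `R` exists: the upper and lower norm-limits are finite and equal. -/
def NormLimitExists {A B : ℝ} (G : Set (Finset (LinInterval A B))) (R : Set ℝ)
    (g : LinInterval A B → ℝ) : Prop :=
  ∃ L : ℝ, upperNormLimit G R g = (L : EReal) ∧ lowerNormLimit G R g = (L : EReal)

/-- The norm-limit of `g` over `R`; meaningful when `NormLimitExists G R g` holds. -/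
noncomputable def normLimit {A B : ℝ} (G : Set (Finset (LinInterval A B))) (R : Set ℝ)
    (g : LinInterval A B → ℝ) : ℝ :=
  (upperNormLimit G R g).toReal

/-- Absolute continuity in `W` of an interval function `h`: the sum of `h` over a finite set of
non-overlapping intervals tends to `0` with the measure of the set that they cover (which is the
sum of their lengths). -/
def IntervalAbsolutelyContinuous {A B : ℝ} (h : LinInterval A B → ℝ) : Prop :=
  ∀ ε > 0, ∃ δ > 0, ∀ T : Finset (LinInterval A B),
    (T : Set (LinInterval A B)).Pairwise LinInterval.NonOverlapping →
      ∑ I ∈ T, I.length < δ → |∑ I ∈ T, h I| < ε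

/-- `K(g; E; I) = g(I) m(E ∩ I) / mI`. -/
noncomputable def densityKernel {A B : ℝ} (g : LinInterval A B → ℝ) (E : Set ℝ)
    (I : LinInterval A B) : ℝ :=
  g I * volume.real (E ∩ I.toSet) / I.length

/-- The upper density integral of `g` over `E`. -/
noncomputable def upperDensityIntegral {A B : ℝ} (G : Set (Finset (LinInterval A B))) (E : Set ℝ)
    (g : LinInterval A B → ℝ) : EReal :=
  upperNormLimit G (Set.Icc A B) (densityKernel g E)

/-- The lower density integral of `g` over `E`. -/
noncomputable def lowerDensityIntegral {A B : ℝ} (G : Set (Finset (LinInterval A B))) (E : Set ℝ)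
    (g : LinInterval A B → ℝ) : EReal :=
  lowerNormLimit G (Set.Icc A B) (densityKernel g E)

/-! ### Elementary facts on intervals. -/

namespace LinInterval

variable {A B : ℝ}

/-! Once the limits are put in ε-form (`HasNormLimit`), the two implications have different sources.

Sufficiency. The norm-limit `N` is additive over divisions, so it is the increment of a point
function `F`, absolutely continuous by hypothesis; hence `N I` is the integral of `f = deriv F` over
`I`. By a Saks-Henstock argument (`HasNormLimit.exists_sum_abs_sub_le`) the sum of `|g I - N I|`
over a fine division is small, and the factor `m(E ∩ I)/mI` is at most one, so `g` may be replaced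
by `N` in the density sums. Those sums replace `f` by its mean on each interval before integrating
over `E`; approximating `f` in L¹ by a continuous function shows that they tend to the integral of
`f` over `E`.

Necessity. For a finite union `R` of intervals, the density integral over `R` is the norm-limit over
`R`, because the kernel is `g` inside `R` and `0` outside. Along a fixed sequence of divisions with
norm tending to zero, the density sums are additive set functions of `E`, each bounded by a multiple
of `m E`, and they converge for every measurable `E`. Vitali-Hahn-Saks
(`exists_forall_abs_limit_le`), proved by Baire category in the complete metric space of measurable
sets, makes the limit small with `m E`; taking for `E` a union of non-overlapping intervals gives
the absolute continuity of `N`. -/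

theorem Ioo_subset_toSet (I : LinInterval A B) : Set.Ioo I.lo I.hi ⊆ I.toSet :=
  fun _ hx => ⟨Or.inl hx.1, Or.inl hx.2⟩

theorem toSet_subset_Icc (I : LinInterval A B) : I.toSet ⊆ Set.Icc I.lo I.hi := by
  rintro x ⟨h1, h2⟩
  have := I.lo_lt_hi
  constructor
  · rcases h1 with h | ⟨-, h⟩ <;> linarith
  · rcases h2 with h | ⟨-, h⟩ <;> linarith

theorem closure_toSet (I : LinInterval A B) : closure I.toSet = Set.Icc I.lo I.hi := by
  apply Set.Subset.antisymm
  · exact closure_minimal I.toSet_subset_Icc isClosed_Icc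
  · rw [← closure_Ioo I.lo_lt_hi.ne]
    exact closure_mono I.Ioo_subset_toSet

theorem Icc_subset (I : LinInterval A B) : Set.Icc I.lo I.hi ⊆ Set.Icc A B :=
  Set.Icc_subset_Icc I.le_lo I.hi_le

theorem length_pos (I : LinInterval A B) : 0 < I.length := sub_pos.2 I.lo_lt_hi

theorem NonOverlapping.symm {I J : LinInterval A B} (h : I.NonOverlapping J) :
    J.NonOverlapping I := Or.symm h

theorem not_nonOverlapping_self (I : LinInterval A B) : ¬ I.NonOverlapping I := by
  have := I.lo_lt_hi
  rintro (h | h) <;> linarith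

theorem NonOverlapping.mono {I J I' J' : LinInterval A B} (h : I.NonOverlapping J)
    (hI : Set.Icc I'.lo I'.hi ⊆ Set.Icc I.lo I.hi) (hJ : Set.Icc J'.lo J'.hi ⊆ Set.Icc J.lo J.hi) :
    I'.NonOverlapping J' := by
  rw [Set.Icc_subset_Icc_iff (I'.lo_lt_hi.le)] at hI
  rw [Set.Icc_subset_Icc_iff (J'.lo_lt_hi.le)] at hJ
  rcases h with h | h
  · left; linarith [hI.2, hJ.1]
  · right; linarith [hI.1, hJ.2]

theorem isISigma_toSet (I : LinInterval A B) : IsISigma A B I.toSet := ⟨{I}, by simp⟩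

end LinInterval

open LinInterval

variable {A B : ℝ}

/-! ### Existence and completion of fine divisions. -/

theorem isISigma_Icc (hAB : A < B) : IsISigma A B (Set.Icc A B) := by
  refine ⟨{⟨A, B, true, true, le_rfl, hAB, le_rfl⟩}, ?_⟩
  ext x
  simp only [Finset.mem_singleton, Set.iUnion_iUnion_eq_left, toSet, true_and, Set.mem_Icc]
  exact and_congr (by rw [le_iff_lt_or_eq, eq_comm]) (by rw [le_iff_lt_or_eq])

theorem isDivision_singleton (I : LinInterval A B) : IsDivision I.toSet {I} := by
  constructor
  · simp
  · simp [I.closure_toSet]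

theorem closure_biUnion_toSet (T : Finset (LinInterval A B)) :
    closure (⋃ I ∈ T, I.toSet) = ⋃ I ∈ T, Set.Icc I.lo I.hi := by
  rw [Finset.closure_biUnion]
  simp_rw [closure_toSet]

theorem isDivision_biUnion {T : Finset (LinInterval A B)}
    (hT : (T : Set (LinInterval A B)).Pairwise NonOverlapping) :
    IsDivision (⋃ I ∈ T, I.toSet) T :=
  ⟨hT, (closure_biUnion_toSet T).symm⟩

theorem IsDivision.Icc_subset {R : Set ℝ} {D : Finset (LinInterval A B)} (h : IsDivision R D)
    {I : LinInterval A B} (hI : I ∈ D) : Set.Icc I.lo I.hi ⊆ closure R := by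
  rw [← h.2]
  exact Set.subset_biUnion_of_mem (u := fun I : LinInterval A B => Set.Icc I.lo I.hi) hI

/-- A division of `[A, B]` of small norm none of whose intervals has a point of `P` in its
interior. -/
theorem exists_division_avoiding (hAB : A < B) (P : Finset ℝ) {e : ℝ} (he : 0 < e) :
    ∃ D : Finset (LinInterval A B), (D : Set (LinInterval A B)).Pairwise NonOverlapping ∧
      (⋃ I ∈ D, Set.Icc I.lo I.hi) = Set.Icc A B ∧ (∀ I ∈ D, I.length < e) ∧
      ∀ I ∈ D, ∀ p ∈ P, I.lo < p → I.hi ≤ p := by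
  classical
  obtain ⟨n, hn⟩ := exists_nat_gt ((B - A) / (e / 2))
  rw [div_lt_iff₀ (by positivity)] at hn
  let Q : Finset ℝ := (P ∪ {A, B} ∪ (Finset.range n).image (fun k : ℕ => A + k * (e / 2))).filter
    (fun x => A ≤ x ∧ x ≤ B)
  have hAQ : A ∈ Q := by simp [Q, hAB.le]
  have hBQ : B ∈ Q := by simp [Q, hAB.le]
  have hQ : ∀ x ∈ Q, A ≤ x ∧ x ≤ B := fun x hx => (Finset.mem_filter.1 hx).2
  -- The cells are the intervals between consecutive points of `Q`; fixing the brackets makes a cell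
  -- determined by its end-points, so there are finitely many.
  let S : Set (LinInterval A B) := {I | (I.leftClosed = true ∧ I.rightClosed = true) ∧
    I.lo ∈ Q ∧ I.hi ∈ Q ∧ ∀ p ∈ Q, I.lo < p → I.hi ≤ p}
  have hS : S.Finite := by
    apply Set.Finite.of_finite_image (f := fun I => (I.lo, I.hi))
    · apply (Q ×ˢ Q).finite_toSet.subset
      rintro _ ⟨I, hI, rfl⟩
      simpa using ⟨hI.2.1, hI.2.2.1⟩
    · rintro I hI J hJ h
      simp only [Prod.mk.injEq] at h
      ext
      · exact h.1
      · exact h.2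
      · rw [hI.1.1, hJ.1.1]
      · rw [hI.1.2, hJ.1.2]
  refine ⟨hS.toFinset, ?_, ?_, ?_, ?_⟩
  · intro I hI J hJ hne
    have hI : I ∈ S := by simpa using hI
    have hJ : J ∈ S := by simpa using hJ
    rcases lt_trichotomy I.lo J.lo with h | h | h
    · exact Or.inl (hI.2.2.2 _ hJ.2.1 h)
    · exfalso
      apply hne
      have h1 := hI.2.2.2 _ hJ.2.2.1 (h ▸ J.lo_lt_hi)
      have h2 := hJ.2.2.2 _ hI.2.2.1 (h ▸ I.lo_lt_hi)
      ext
      · exact h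
      · exact le_antisymm h1 h2
      · rw [hI.1.1, hJ.1.1]
      · rw [hI.1.2, hJ.1.2]
    · exact Or.inr (hJ.2.2.2 _ hI.2.1 h)
  · apply Set.Subset.antisymm
    · exact Set.iUnion₂_subset fun I _ => I.Icc_subset
    · rintro t ⟨hAt, htB⟩
      suffices h : ∃ a ∈ Q, ∃ b ∈ Q, a < b ∧ a ≤ t ∧ t ≤ b ∧ ∀ p ∈ Q, a < p → b ≤ p by
        obtain ⟨a, ha, b, hb, hab, h1, h2, h3⟩ := h
        simp only [Set.mem_iUnion]
        refine ⟨⟨a, b, true, true, (hQ a ha).1, hab, (hQ b hb).2⟩, ?_, h1, h2⟩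
        simpa [S] using ⟨ha, hb, h3⟩
      rcases htB.lt_or_eq with htB | rfl
      · obtain ⟨a, ha, ha'⟩ := (Q.filter (· ≤ t)).exists_max_image id ⟨A, by simp [hAQ, hAt]⟩
        obtain ⟨b, hb, hb'⟩ := (Q.filter (t < ·)).exists_min_image id ⟨B, by simp [hBQ, htB]⟩
        simp only [Finset.mem_filter, id, and_imp] at ha hb ha' hb'
        refine ⟨a, ha.1, b, hb.1, by linarith [ha.2, hb.2], ha.2, hb.2.le, fun p hp hap => ?_⟩
        rcases le_or_gt p t with h | h
        · linarith [ha' p hp h]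
        · exact hb' p hp h
      · obtain ⟨a, ha, ha'⟩ := (Q.filter (· < t)).exists_max_image id ⟨A, by simp [hAQ, hAB]⟩
        simp only [Finset.mem_filter, id, and_imp] at ha ha'
        refine ⟨a, ha.1, t, hBQ, ha.2, ha.2.le, le_rfl, fun p hp hap => ?_⟩
        by_contra h
        linarith [ha' p hp (not_le.1 h)]
  · intro I hI
    have hI : I ∈ S := by simpa using hI
    have hlo := I.le_lo
    let k := ⌊(I.lo - A) / (e / 2)⌋₊
    have h0 : 0 ≤ (I.lo - A) / (e / 2) := by
      apply div_nonneg <;> linarith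
    have h1 : (k : ℝ) * (e / 2) ≤ I.lo - A := by
      rw [← le_div_iff₀ (by positivity)]; exact Nat.floor_le h0
    have h2 : I.lo - A < ((k : ℝ) + 1) * (e / 2) := by
      rw [← div_lt_iff₀ (by positivity)]; exact Nat.lt_floor_add_one _
    -- `I.lo` lies in the `k`-th mesh cell of width `e / 2`. Either the next mesh point belongs to
    -- `Q` and stops `I`, or `B` comes early enough to stop it.
    by_cases hB : A + ((k + 1 : ℕ) : ℝ) * (e / 2) ≤ B ∧ k + 1 < n
    · have hmem : A + ((k + 1 : ℕ) : ℝ) * (e / 2) ∈ Q := by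
        simp only [Q, Finset.mem_filter, Finset.mem_union, Finset.mem_image, Finset.mem_range]
        refine ⟨Or.inr ⟨k + 1, hB.2, rfl⟩, ?_, hB.1⟩
        have : 0 ≤ ((k + 1 : ℕ) : ℝ) * (e / 2) := by positivity
        linarith
      have := hI.2.2.2 _ hmem (by push_cast; linarith)
      push_cast at this
      unfold length
      linarith
    · have hlt : B < A + (k + 1) * (e / 2) + e / 4 := by
        by_cases h : A + ((k + 1 : ℕ) : ℝ) * (e / 2) ≤ B
        · have : n ≤ k + 1 := by by_contra h'; exact hB ⟨h, not_le.1 h'⟩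
          have : (n : ℝ) ≤ k + 1 := by exact_mod_cast this
          nlinarith
        · push_cast at h
          linarith
      have := I.hi_le
      unfold length
      linarith
  · intro I hI p hp hlt
    have hI : I ∈ S := by simpa using hI
    by_cases hpB : p ≤ B
    · refine hI.2.2.2 p ?_ hlt
      simp only [Q, Finset.mem_filter, Finset.mem_union]
      exact ⟨Or.inl (Or.inl hp), I.le_lo.trans hlt.le, hpB⟩
    · linarith [I.hi_le]

theorem exists_fine_division {R : Set ℝ} (hR : IsISigma A B R) {e : ℝ} (he : 0 < e) :
    ∃ D : Finset (LinInterval A B), IsDivision R D ∧ ∀ I ∈ D, I.length < e := by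
  classical
  obtain ⟨T, rfl⟩ := hR
  rcases T.eq_empty_or_nonempty with rfl | ⟨J₀, -⟩
  · exact ⟨∅, by simp [IsDivision], by simp⟩
  have hAB : A < B := J₀.le_lo.trans_lt (J₀.lo_lt_hi.trans_le J₀.hi_le)
  obtain ⟨D, hD, hcov, hfine, havoid⟩ :=
    exists_division_avoiding hAB (T.image lo ∪ T.image hi) he
  -- No end-point of `T` is interior to a cell of `D`, so a cell meeting the interior of some `J ∈
  -- T` lies inside `J`.
  refine ⟨D.filter fun I => Set.Ioo I.lo I.hi ⊆ ⋃ J ∈ T, J.toSet, ⟨?_, ?_⟩, ?_⟩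
  · exact hD.mono (Finset.coe_subset.2 (Finset.filter_subset _ _))
  · apply Set.Subset.antisymm
    · refine Set.iUnion₂_subset fun I hI => ?_
      rw [← closure_Ioo I.lo_lt_hi.ne]
      exact closure_mono (Finset.mem_filter.1 hI).2
    · rw [closure_biUnion_toSet]
      refine Set.iUnion₂_subset fun J hJ => ?_
      rw [← closure_Ioo J.lo_lt_hi.ne]
      refine closure_minimal ?_ (isClosed_biUnion_finset fun _ _ => isClosed_Icc)
      rintro x ⟨hx1, hx2⟩
      have hx : x ∈ ⋃ I ∈ D, Set.Icc I.lo I.hi := by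
        rw [hcov]; exact J.Icc_subset ⟨hx1.le, hx2.le⟩
      simp only [Set.mem_iUnion] at hx ⊢
      obtain ⟨I, hI, hxI⟩ := hx
      refine ⟨I, Finset.mem_filter.2 ⟨hI, ?_⟩, hxI⟩
      have h1 : J.lo ≤ I.lo := by
        by_contra h
        have := havoid I hI J.lo
          (Finset.mem_union_left _ (Finset.mem_image_of_mem _ hJ)) (not_le.1 h)
        linarith [hxI.2]
      have h2 : I.hi ≤ J.hi := havoid I hI J.hi
          (Finset.mem_union_right _ (Finset.mem_image_of_mem _ hJ)) (by linarith [hxI.1])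
      refine (Set.Ioo_subset_Ioo h1 h2).trans (J.Ioo_subset_toSet.trans ?_)
      exact Set.subset_biUnion_of_mem (u := fun J : LinInterval A B => J.toSet) hJ
  · exact fun I hI => hfine I (Finset.mem_filter.1 hI).1

open Classical in
/-- Finitely many non-overlapping intervals extend to a division of `[A, B]` by intervals of
arbitrarily small length. -/
theorem exists_completion (hAB : A < B) {D₁ : Finset (LinInterval A B)}
    (hD₁ : (D₁ : Set (LinInterval A B)).Pairwise NonOverlapping) {e : ℝ} (he : 0 < e) :
    ∃ D₂ : Finset (LinInterval A B), Disjoint D₁ D₂ ∧ IsDivision (Set.Icc A B) (D₁ ∪ D₂) ∧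
      ∀ I ∈ D₂, I.length < e := by
  obtain ⟨D, hD, hcov, hfine, havoid⟩ :=
    exists_division_avoiding hAB (D₁.image lo ∪ D₁.image hi) he
  -- The discarded cells overlap some `J ∈ D₁` and, having no end-point of `J` in their interior,
  -- are contained in it.
  refine ⟨D.filter fun I => ∀ J ∈ D₁, I.NonOverlapping J, ?_, ⟨?_, ?_⟩, ?_⟩
  · rw [Finset.disjoint_left]
    intro I hI hI'
    exact I.not_nonOverlapping_self ((Finset.mem_filter.1 hI').2 I hI)
  · intro I hI J hJ hne
    simp only [Finset.coe_union, Finset.coe_filter, Set.mem_union, Finset.mem_coe,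
      Set.mem_ofPred_eq] at hI hJ
    rcases hI with hI | hI <;> rcases hJ with hJ | hJ
    · exact hD₁ hI hJ hne
    · exact (hJ.2 I hI).symm
    · exact hI.2 J hJ
    · exact hD hI.1 hJ.1 hne
  · rw [isClosed_Icc.closure_eq]
    apply Set.Subset.antisymm
    · exact Set.iUnion₂_subset fun I _ => I.Icc_subset
    · rw [← hcov]
      refine Set.iUnion₂_subset fun I hI => ?_
      by_cases h : ∀ J ∈ D₁, I.NonOverlapping J
      · exact Set.subset_biUnion_of_mem (u := fun J : LinInterval A B => Set.Icc J.lo J.hi)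
          (Finset.mem_union_right _ (Finset.mem_filter.2 ⟨hI, h⟩))
      · push Not at h
        obtain ⟨J, hJ, hIJ⟩ := h
        simp only [NonOverlapping, not_or, not_le] at hIJ
        refine Set.Subset.trans (Set.Icc_subset_Icc ?_ ?_)
          (Set.subset_biUnion_of_mem (u := fun J : LinInterval A B => Set.Icc J.lo J.hi)
            (Finset.mem_union_left _ hJ))
        · by_contra h
          have := havoid I hI J.lo
            (Finset.mem_union_left _ (Finset.mem_image_of_mem _ hJ)) (not_le.1 h)
          linarith
        · exact havoid I hI J.hi
            (Finset.mem_union_right _ (Finset.mem_image_of_mem _ hJ)) hIJ.2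
  · exact fun I hI => hfine I (Finset.mem_filter.1 hI).1

/-! ### Refinement of divisions. -/

section Refinement

open Classical in
theorem IsDivision.biUnion {R : Set ℝ} {T : Finset (LinInterval A B)} (hT : IsDivision R T)
    {F : LinInterval A B → Finset (LinInterval A B)}
    (hF : ∀ I ∈ T, IsDivision I.toSet (F I)) : IsDivision R (T.biUnion F) := by
  have hsub : ∀ I ∈ T, ∀ J ∈ F I, Set.Icc J.lo J.hi ⊆ Set.Icc I.lo I.hi := by
    intro I hI J hJ
    rw [← I.closure_toSet]
    exact (hF I hI).Icc_subset hJ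
  constructor
  · intro K hK L hL hne
    simp only [Finset.coe_biUnion, Set.mem_iUnion, Finset.mem_coe] at hK hL
    obtain ⟨I, hI, hK⟩ := hK
    obtain ⟨J, hJ, hL⟩ := hL
    by_cases hIJ : I = J
    · subst hIJ
      exact (hF I hI).1 hK hL hne
    · exact (hT.1 hI hJ hIJ).mono (hsub I hI K hK) (hsub J hJ L hL)
  · rw [← hT.2, Finset.set_biUnion_biUnion]
    refine Set.iUnion₂_congr fun I hI => ?_
    rw [(hF I hI).2, I.closure_toSet]

open Classical in
theorem IsDivision.sum_biUnion {R : Set ℝ} {T : Finset (LinInterval A B)} (hT : IsDivision R T)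
    {F : LinInterval A B → Finset (LinInterval A B)}
    (hF : ∀ I ∈ T, IsDivision I.toSet (F I)) (g : LinInterval A B → ℝ) :
    ∑ J ∈ T.biUnion F, g J = ∑ I ∈ T, ∑ J ∈ F I, g J := by
  apply Finset.sum_biUnion
  intro I hI J hJ hIJ
  simp only [Function.onFun]
  rw [Finset.disjoint_left]
  intro K hKI hKJ
  refine K.not_nonOverlapping_self ((hT.1 hI hJ hIJ).mono ?_ ?_)
  · rw [← I.closure_toSet]
    exact (hF I hI).Icc_subset hKI
  · rw [← J.closure_toSet]
    exact (hF J hJ).Icc_subset hKJ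

end Refinement

/-! ### Norm-limits in ε-form. -/

/-- The sums of `g` over divisions of `R` tend to `L` as the norm tends to zero. -/
def HasNormLimit (R : Set ℝ) (g : LinInterval A B → ℝ) (L : ℝ) : Prop :=
  ∀ ε > 0, ∃ e > 0, ∀ D : Finset (LinInterval A B), IsDivision R D → (∀ I ∈ D, I.length < e) →
    |∑ I ∈ D, g I - L| ≤ ε

theorem mem_fineDivisions_iff {R : Set ℝ} (hR : IsISigma A B R) {e : ℝ}
    {D : Finset (LinInterval A B)} :
    D ∈ fineDivisions (G1 A B) R e ↔ IsDivision R D ∧ ∀ I ∈ D, I.length < e :=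
  ⟨fun h => h.2, fun h => ⟨⟨R, hR, h.1⟩, h⟩⟩

theorem normLimits_eq_iff {R : Set ℝ} (hR : IsISigma A B R) (g : LinInterval A B → ℝ) (L : ℝ) :
    (upperNormLimit (G1 A B) R g = L ∧ lowerNormLimit (G1 A B) R g = L) ↔
      HasNormLimit R g L := by
  constructor
  · rintro ⟨hu, hl⟩ ε hε
    have h1 : upperNormLimit (G1 A B) R g < ((L + ε : ℝ) : EReal) := by
      rw [hu]; exact_mod_cast (by linarith)
    have h2 : ((L - ε : ℝ) : EReal) < lowerNormLimit (G1 A B) R g := by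
      rw [hl]; exact_mod_cast (by linarith)
    simp only [upperNormLimit, iInf_lt_iff] at h1
    simp only [lowerNormLimit, lt_iSup_iff] at h2
    obtain ⟨e₁, he₁, h1⟩ := h1
    obtain ⟨e₂, he₂, h2⟩ := h2
    refine ⟨min e₁ e₂, lt_min he₁ he₂, fun D hD hfine => ?_⟩
    have hD1 : D ∈ fineDivisions (G1 A B) R e₁ := (mem_fineDivisions_iff hR).2
      ⟨hD, fun I hI => (hfine I hI).trans_le (min_le_left _ _)⟩
    have hD2 : D ∈ fineDivisions (G1 A B) R e₂ := (mem_fineDivisions_iff hR).2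
      ⟨hD, fun I hI => (hfine I hI).trans_le (min_le_right _ _)⟩
    have h1' := (le_iSup₂ (f := fun D (_ : D ∈ fineDivisions (G1 A B) R e₁) =>
      ((∑ I ∈ D, g I : ℝ) : EReal)) D hD1).trans_lt h1
    have h2' := h2.trans_le (iInf₂_le (f := fun D (_ : D ∈ fineDivisions (G1 A B) R e₂) =>
      ((∑ I ∈ D, g I : ℝ) : EReal)) D hD2)
    have h1'' : ∑ I ∈ D, g I < L + ε := EReal.coe_lt_coe_iff.1 h1'
    have h2'' : L - ε < ∑ I ∈ D, g I := EReal.coe_lt_coe_iff.1 h2'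
    rw [abs_le]
    constructor <;> linarith
  · intro h
    -- This needs fine divisions of `R` to exist: otherwise the suprema would be `⊥` and the infima
    -- `⊤`.
    have hle : lowerNormLimit (G1 A B) R g ≤ upperNormLimit (G1 A B) R g := by
      refine iSup₂_le fun e₁ he₁ => le_iInf₂ fun e₂ he₂ => ?_
      obtain ⟨D, hD, hfine⟩ := exists_fine_division hR (lt_min he₁ he₂)
      refine (iInf₂_le D ((mem_fineDivisions_iff hR).2
        ⟨hD, fun I hI => (hfine I hI).trans_le (min_le_left _ _)⟩)).trans ?_
      exact le_iSup₂ (f := fun D (_ : D ∈ fineDivisions (G1 A B) R e₂) =>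
        ((∑ I ∈ D, g I : ℝ) : EReal)) D ((mem_fineDivisions_iff hR).2
        ⟨hD, fun I hI => (hfine I hI).trans_le (min_le_right _ _)⟩)
    have hu : upperNormLimit (G1 A B) R g ≤ L := by
      refine EReal.le_of_forall_lt_iff_le.1 fun z hz => ?_
      have hz : L < z := by exact_mod_cast hz
      obtain ⟨e, he, h⟩ := h (z - L) (by linarith)
      refine (iInf₂_le e he).trans (iSup₂_le fun D hD => ?_)
      have := h D hD.2.1 hD.2.2
      rw [abs_le] at this
      exact_mod_cast (by linarith)
    have hl : (L : EReal) ≤ lowerNormLimit (G1 A B) R g := by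
      refine EReal.ge_of_forall_gt_iff_ge.1 fun z hz => ?_
      have hz : z < L := by exact_mod_cast hz
      obtain ⟨e, he, h⟩ := h (L - z) (by linarith)
      refine le_trans ?_ (le_iSup₂ (f := fun e (_ : 0 < e) =>
        ⨅ D ∈ fineDivisions (G1 A B) R e, ((∑ I ∈ D, g I : ℝ) : EReal)) e he)
      refine le_iInf₂ fun D hD => ?_
      have := h D hD.2.1 hD.2.2
      rw [abs_le] at this
      exact_mod_cast (by linarith)
    exact ⟨hu.antisymm (hl.trans hle), (hle.trans hu).antisymm hl⟩

theorem HasNormLimit.normLimit_eq {R : Set ℝ} (hR : IsISigma A B R) {g : LinInterval A B → ℝ}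
    {L : ℝ} (h : HasNormLimit R g L) : normLimit (G1 A B) R g = L := by
  rw [normLimit, ((normLimits_eq_iff hR g L).2 h).1, EReal.toReal_coe]

theorem NormLimitExists.hasNormLimit {R : Set ℝ} (hR : IsISigma A B R) {g : LinInterval A B → ℝ}
    (h : NormLimitExists (G1 A B) R g) : HasNormLimit R g (normLimit (G1 A B) R g) := by
  obtain ⟨L, hL⟩ := h
  have := (normLimits_eq_iff hR g L).1 hL
  rwa [this.normLimit_eq hR]

theorem HasNormLimit.exists_division {R : Set ℝ} (hR : IsISigma A B R) {g : LinInterval A B → ℝ}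
    {L : ℝ} (h : HasNormLimit R g L) {ε e : ℝ} (hε : 0 < ε) (he : 0 < e) :
    ∃ D : Finset (LinInterval A B), IsDivision R D ∧ (∀ I ∈ D, I.length < e) ∧
      |∑ I ∈ D, g I - L| ≤ ε := by
  obtain ⟨e', he', h⟩ := h ε hε
  obtain ⟨D, hD, hfine⟩ := exists_fine_division hR (lt_min he he')
  exact ⟨D, hD, fun I hI => (hfine I hI).trans_le (min_le_left _ _),
    h D hD fun I hI => (hfine I hI).trans_le (min_le_right _ _)⟩

/-! ### Additivity of the norm-limit and the Saks-Henstock lemma. -/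

theorem abs_sum_sub_sum_le {ι : Type*} (T : Finset ι) (a b : ι → ℝ) {ε : ℝ} (hε : 0 < ε)
    (h : ∀ i ∈ T, |a i - b i| ≤ ε / (T.card + 1)) : |∑ i ∈ T, a i - ∑ i ∈ T, b i| ≤ ε := by
  rw [← Finset.sum_sub_distrib]
  calc |∑ i ∈ T, (a i - b i)| ≤ ∑ i ∈ T, |a i - b i| := Finset.abs_sum_le_sum_abs _ _
    _ ≤ T.card • (ε / (T.card + 1)) := Finset.sum_le_card_nsmul _ _ _ h
    _ = ε * (T.card / (T.card + 1)) := by rw [nsmul_eq_mul]; ring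
    _ ≤ ε * 1 := by
      gcongr
      rw [div_le_one (by positivity)]
      linarith
    _ = ε := mul_one _

/-- The norm-limit is additive over the intervals of a division. -/
theorem HasNormLimit.eq_sum {R : Set ℝ} {g : LinInterval A B → ℝ}
    {L : ℝ} (h : HasNormLimit R g L) {N : LinInterval A B → ℝ} {T : Finset (LinInterval A B)}
    (hT : IsDivision R T) (hN : ∀ I ∈ T, HasNormLimit I.toSet g (N I)) :
    L = ∑ I ∈ T, N I := by
  classical
  refine eq_of_forall_dist_le fun ε hε => ?_
  obtain ⟨e, he, h⟩ := h (ε / 2) (by positivity)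
  -- Each `I ∈ T` is cut finely enough that its `g`-sum is nearly `N I`; together the pieces form a
  -- fine division of `R`, whose sum is also nearly `L`.
  have hF : ∀ I, ∃ D : Finset (LinInterval A B), I ∈ T → IsDivision I.toSet D ∧
      (∀ J ∈ D, J.length < e) ∧ |∑ J ∈ D, g J - N I| ≤ (ε / 2) / (T.card + 1) := by
    intro I
    by_cases hI : I ∈ T
    · obtain ⟨D, hD⟩ := (hN I hI).exists_division I.isISigma_toSet
        (ε := (ε / 2) / (T.card + 1)) (by positivity) he
      exact ⟨D, fun _ => hD⟩
    · exact ⟨∅, fun h => absurd h hI⟩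
  choose F hF using hF
  have h1 := h (T.biUnion F) (hT.biUnion fun I hI => (hF I hI).1) fun J hJ => by
    obtain ⟨I, hI, hJ⟩ := Finset.mem_biUnion.1 hJ
    exact (hF I hI).2.1 J hJ
  rw [hT.sum_biUnion fun I hI => (hF I hI).1] at h1
  have h2 := abs_sum_sub_sum_le T (fun I => ∑ J ∈ F I, g J) N (by positivity : 0 < ε / 2)
    fun I hI => (hF I hI).2.2
  rw [Real.dist_eq]
  rw [abs_le] at *
  constructor <;> linarith

/-- Split by sign: the nonnegative and the negative terms each contribute at most `c`. This turns
bounds on `|∑|` over all subfamilies into bounds on `∑ |·|`. -/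
theorem sum_abs_le_of_forall_subset {ι : Type*} (T : Finset ι) (a : ι → ℝ) {c : ℝ}
    (h : ∀ S ⊆ T, |∑ i ∈ S, a i| ≤ c) : ∑ i ∈ T, |a i| ≤ 2 * c := by
  classical
  rw [← Finset.sum_filter_add_sum_filter_not T (fun i => 0 ≤ a i)]
  have h1 : ∑ i ∈ T with 0 ≤ a i, |a i| ≤ c := by
    rw [Finset.sum_congr rfl fun i hi => abs_of_nonneg (Finset.mem_filter.1 hi).2]
    exact (le_abs_self _).trans (h _ (Finset.filter_subset _ _))
  have h2 : ∑ i ∈ T with ¬ 0 ≤ a i, |a i| ≤ c := by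
    rw [Finset.sum_congr rfl fun i hi =>
      abs_of_neg (not_le.1 (Finset.mem_filter.1 hi).2), Finset.sum_neg_distrib]
    exact (neg_le_abs _).trans (h _ (Finset.filter_subset _ _))
  linarith

/-- A Saks-Henstock lemma: `g` is close to its norm-limit `N` on all fine families of
non-overlapping intervals at once. -/
theorem HasNormLimit.exists_sum_abs_sub_le (hAB : A < B) {g N : LinInterval A B → ℝ} {L : ℝ}
    (h : HasNormLimit (Set.Icc A B) g L)
    (hN : ∀ I : LinInterval A B, HasNormLimit I.toSet g (N I)) {ε : ℝ} (hε : 0 < ε) :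
    ∃ e > 0, ∀ D : Finset (LinInterval A B),
      (D : Set (LinInterval A B)).Pairwise NonOverlapping → (∀ I ∈ D, I.length < e) →
      ∑ I ∈ D, |g I - N I| ≤ ε := by
  classical
  obtain ⟨e, he, he'⟩ := h (ε / 4) (by positivity)
  refine ⟨e, he, fun D hD hfine => ?_⟩
  refine (sum_abs_le_of_forall_subset (c := ε / 2) D _ fun D₁ hD₁ => ?_).trans_eq (by ring)
  -- The norm of `D₂` is irrelevant: its members are subdivided below until their `g`-sums are
  -- nearly `N`. What is left of the total error then falls on `D₁`.
  obtain ⟨D₂, hdisj, hdiv, -⟩ := exists_completion hAB (hD.mono (Finset.coe_subset.2 hD₁)) one_pos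
  have hL := h.eq_sum hdiv fun I _ => hN I
  choose F hF1 hF2 hF3 using fun I : LinInterval A B => (hN I).exists_division I.isISigma_toSet
    (ε := (ε / 4) / (D₂.card + 1)) (by positivity) he
  let F' : LinInterval A B → Finset (LinInterval A B) := fun I => if I ∈ D₁ then {I} else F I
  have hF' : ∀ I ∈ D₁ ∪ D₂, IsDivision I.toSet (F' I) := by
    intro I _
    by_cases hI : I ∈ D₁
    · simp only [F', if_pos hI]
      exact isDivision_singleton I
    · simp only [F', if_neg hI]
      exact hF1 I
  have h1 := he' _ (hdiv.biUnion hF') fun J hJ => by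
    obtain ⟨I, -, hJ⟩ := Finset.mem_biUnion.1 hJ
    by_cases hI : I ∈ D₁
    · simp only [F', hI, if_true, Finset.mem_singleton] at hJ
      exact hJ ▸ hfine I (hD₁ hI)
    · simp only [F', hI, if_false] at hJ
      exact hF2 I J hJ
  rw [hdiv.sum_biUnion hF', Finset.sum_union hdisj, hL, Finset.sum_union hdisj] at h1
  have h2 : ∑ I ∈ D₁, ∑ J ∈ F' I, g J = ∑ I ∈ D₁, g I :=
    Finset.sum_congr rfl fun I hI => by simp [F', hI]
  have h3 : ∑ I ∈ D₂, ∑ J ∈ F' I, g J = ∑ I ∈ D₂, ∑ J ∈ F I, g J :=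
    Finset.sum_congr rfl fun I hI => by simp [F', Finset.disjoint_right.1 hdisj hI]
  have h4 := abs_sum_sub_sum_le D₂ (fun I => ∑ J ∈ F I, g J) N (by positivity : 0 < ε / 4)
    fun I _ => hF3 I
  rw [Finset.sum_sub_distrib]
  rw [h2, h3] at h1
  rw [abs_le] at *
  constructor <;> linarith

/-! ### From the interval function to a point function. -/

theorem absolutelyContinuousOnInterval_of_forall_eq_sub (hAB : A < B) {N : LinInterval A B → ℝ}
    (hN : IntervalAbsolutelyContinuous N) {F : ℝ → ℝ}
    (hF : ∀ I : LinInterval A B, N I = F I.hi - F I.lo) : AbsolutelyContinuousOnInterval F A B := by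
  classical
  rw [absolutelyContinuousOnInterval_iff]
  intro ε hε
  -- Passing from `|∑|` to `∑ |·|` doubles the bound, and `2 * (ε / 3) < ε` keeps the inequality
  -- strict.
  obtain ⟨δ, hδ, h⟩ := hN (ε / 3) (by positivity)
  refine ⟨δ, hδ, ?_⟩
  rintro ⟨n, J⟩ ⟨hmem, hdisj⟩ hlen
  simp only [Set.uIcc_of_le hAB.le, Finset.mem_range] at hmem hdisj hlen ⊢
  -- Pairs with equal entries are not intervals; they contribute nothing to either sum.
  let S := (Finset.range n).filter fun i => (J i).1 ≠ (J i).2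
  have hK : ∀ i, ∃ K : LinInterval A B, i ∈ S →
      K.lo = min (J i).1 (J i).2 ∧ K.hi = max (J i).1 (J i).2 := by
    intro i
    by_cases hi : i ∈ S
    · obtain ⟨hin, hne⟩ := Finset.mem_filter.1 hi
      have := hmem i (Finset.mem_range.1 hin)
      exact ⟨⟨min (J i).1 (J i).2, max (J i).1 (J i).2, true, true,
        le_min this.1.1 this.2.1, min_lt_max.2 hne, max_le this.1.2 this.2.2⟩, fun _ => ⟨rfl, rfl⟩⟩
    · exact ⟨⟨A, B, true, true, le_rfl, hAB, le_rfl⟩, fun h => absurd h hi⟩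
  choose K hK using hK
  have hnon : ∀ i ∈ S, ∀ j ∈ S, i ≠ j → (K i).NonOverlapping (K j) := by
    intro i hi j hj hij
    have := hdisj (Finset.mem_filter.1 hi).1 (Finset.mem_filter.1 hj).1 hij
    simp only [Function.onFun, Set.uIoc, ← (hK i hi).1, ← (hK i hi).2, ← (hK j hj).1,
      ← (hK j hj).2, Set.Ioc_disjoint_Ioc] at this
    have h1 := (K i).lo_lt_hi
    have h2 := (K j).lo_lt_hi
    rcases min_le_iff.1 this with h | h <;> rcases le_max_iff.1 h with h | h
    · linarith
    · exact Or.inl h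
    · exact Or.inr h
    · linarith
  have hinj : Set.InjOn K S := by
    intro i hi j hj hij
    by_contra hne
    exact (K j).not_nonOverlapping_self (hij ▸ hnon i hi j hj hne)
  have hlen_eq : ∀ i ∈ S, (K i).length = dist (J i).1 (J i).2 := by
    intro i hi
    rw [length, (hK i hi).1, (hK i hi).2, max_sub_min_eq_abs', Real.dist_eq]
  have hdist : ∀ i ∈ S, dist (F (J i).1) (F (J i).2) = |N (K i)| := by
    intro i hi
    rw [hF, (hK i hi).1, (hK i hi).2, Real.dist_eq]
    rcases le_total (J i).1 (J i).2 with h | h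
    · rw [min_eq_left h, max_eq_right h, abs_sub_comm]
    · rw [min_eq_right h, max_eq_left h]
  have hsum : ∑ i ∈ Finset.range n, dist (F (J i).1) (F (J i).2) = ∑ i ∈ S, |N (K i)| := by
    rw [← Finset.sum_congr rfl hdist]
    symm
    apply Finset.sum_subset (Finset.filter_subset _ _)
    intro i hi hiS
    have : (J i).1 = (J i).2 := by
      by_contra hne
      exact hiS (Finset.mem_filter.2 ⟨hi, hne⟩)
    rw [this, dist_self]
  rw [hsum]
  refine (sum_abs_le_of_forall_subset (c := ε / 3) S _ fun S' hS' => ?_).trans_lt (by linarith)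
  have := h (S'.image K) ?_ ?_
  · rw [Finset.sum_image (hinj.mono (Finset.coe_subset.2 hS'))] at this
    exact this.le
  · rintro _ hI _ hJ hne
    obtain ⟨i, hi, rfl⟩ := Finset.mem_image.1 hI
    obtain ⟨j, hj, rfl⟩ := Finset.mem_image.1 hJ
    exact hnon i (hS' hi) j (hS' hj) fun hij => hne (hij ▸ rfl)
  · rw [Finset.sum_image (hinj.mono (Finset.coe_subset.2 hS'))]
    refine lt_of_le_of_lt ?_ hlen
    rw [Finset.sum_congr rfl fun i hi => hlen_eq i (hS' hi)]
    exact Finset.sum_le_sum_of_subset_of_nonneg (hS'.trans (Finset.filter_subset _ _))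
      fun _ _ _ => dist_nonneg

/-- Take `F x` to be `N` of `[A, x]`, with `F A = 0`, and use additivity. Brackets do not matter,
since a division only sees closures. -/
theorem exists_forall_eq_sub {g N : LinInterval A B → ℝ}
    (hN : ∀ I : LinInterval A B, HasNormLimit I.toSet g (N I)) :
    ∃ F : ℝ → ℝ, ∀ I : LinInterval A B, N I = F I.hi - F I.lo := by
  classical
  let F : ℝ → ℝ := fun x => if h : A < x ∧ x ≤ B then N ⟨A, x, true, true, le_rfl, h.1, h.2⟩ else 0
  refine ⟨F, fun I => ?_⟩
  have hhi : A < I.hi ∧ I.hi ≤ B := ⟨I.le_lo.trans_lt I.lo_lt_hi, I.hi_le⟩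
  let K : LinInterval A B := ⟨A, I.hi, true, true, le_rfl, hhi.1, hhi.2⟩
  have h1 : F I.hi = N K := dif_pos hhi
  rcases I.le_lo.eq_or_lt with h | h
  · have h2 : F I.lo = 0 := dif_neg fun h' => h'.1.ne h
    have hdiv : IsDivision K.toSet {I} := by
      refine ⟨by simp, ?_⟩
      rw [K.closure_toSet]
      simp [K, h]
    have := (hN K).eq_sum hdiv fun I _ => hN I
    rw [h1, h2, this]
    simp
  · have hlo : A < I.lo ∧ I.lo ≤ B := ⟨h, I.lo_lt_hi.le.trans I.hi_le⟩
    let J : LinInterval A B := ⟨A, I.lo, true, true, le_rfl, hlo.1, hlo.2⟩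
    have h2 : F I.lo = N J := dif_pos hlo
    have hJI : J.NonOverlapping I := Or.inl le_rfl
    have hne : J ≠ I := fun h => I.not_nonOverlapping_self (h ▸ hJI)
    have hdiv : IsDivision K.toSet {J, I} := by
      constructor
      · rw [Finset.coe_pair, Set.pairwise_pair]
        exact fun _ => ⟨hJI, hJI.symm⟩
      · rw [K.closure_toSet]
        simp only [Finset.mem_insert, Finset.mem_singleton, Set.iUnion_iUnion_eq_or_left,
          Set.iUnion_iUnion_eq_left]
        exact Set.Icc_union_Icc_eq_Icc h.le I.lo_lt_hi.le
    have := (hN K).eq_sum hdiv fun I _ => hN I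
    rw [Finset.sum_pair hne] at this
    rw [h1, h2, this]
    ring

/-! ### Sufficiency: convergence of the density sums. -/

/-- Subtracting `c` from `f` changes both terms by `c * μ.real E`, so their difference is
unaffected; after that, each term is at most `∫ |f - c|`. -/
theorem abs_average_indicator_sub_le {α : Type*} [MeasurableSpace α] {μ : Measure α}
    [IsFiniteMeasure μ] (hμ : μ.real Set.univ ≠ 0) {E : Set α} (hE : MeasurableSet E) {f : α → ℝ}
    (hf : Integrable f μ) (c : ℝ) :
    |(∫ x, f x ∂μ) * μ.real E / μ.real Set.univ - ∫ x, E.indicator f x ∂μ| ≤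
      2 * ∫ x, |f x - c| ∂μ := by
  have hfc : Integrable (fun x => f x - c) μ := hf.sub (integrable_const c)
  have hint := integral_sub hf (integrable_const c)
  have hind : ∫ x, E.indicator f x ∂μ = ∫ x, E.indicator (fun x => f x - c) x ∂μ + c * μ.real E := by
    rw [integral_indicator hE, integral_indicator hE,
      integral_sub hf.integrableOn (integrable_const c).integrableOn]
    simp [mul_comm]
  rw [integral_const, smul_eq_mul] at hint
  have h1 : |∫ x, (f x - c) ∂μ| ≤ ∫ x, |f x - c| ∂μ := abs_integral_le_integral_abs
  have h2 : |∫ x, E.indicator (fun x => f x - c) x ∂μ| ≤ ∫ x, |f x - c| ∂μ := by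
    refine abs_integral_le_integral_abs.trans
      (integral_mono (hfc.indicator hE).abs hfc.abs fun x => ?_)
    by_cases hx : x ∈ E <;> simp [hx]
  have h3 : |(∫ x, (f x - c) ∂μ) * (μ.real E / μ.real Set.univ)| ≤ ∫ x, |f x - c| ∂μ := by
    rw [abs_mul]
    have : |μ.real E / μ.real Set.univ| ≤ 1 := by
      rw [abs_of_nonneg (by positivity)]
      exact div_le_one_of_le₀ (measureReal_mono (Set.subset_univ E)) measureReal_nonneg
    exact (mul_le_of_le_one_right (abs_nonneg _) this).trans h1
  have : (∫ x, f x ∂μ) * μ.real E / μ.real Set.univ - ∫ x, E.indicator f x ∂μ =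
      (∫ x, (f x - c) ∂μ) * (μ.real E / μ.real Set.univ) -
        ∫ x, E.indicator (fun x => f x - c) x ∂μ := by
    rw [hind, hint]
    field_simp
    ring
  rw [this, two_mul]
  exact (abs_sub _ _).trans (add_le_add h3 h2)

namespace LinInterval

theorem Ioo_ae_eq_toSet (I : LinInterval A B) : Set.Ioo I.lo I.hi =ᵐ[volume] I.toSet := by
  refine Filter.EventuallyLE.antisymm (LE.le.eventuallyLE I.Ioo_subset_toSet) ?_
  exact (LE.le.eventuallyLE I.toSet_subset_Icc).trans Ioo_ae_eq_Icc.symm.le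

theorem NonOverlapping.disjoint_Ioo {I J : LinInterval A B} (h : I.NonOverlapping J) :
    Disjoint (Set.Ioo I.lo I.hi) (Set.Ioo J.lo J.hi) := by
  rw [Set.disjoint_left]
  rintro x ⟨h1, h2⟩ ⟨h3, h4⟩
  rcases h with h | h <;> linarith

end LinInterval

theorem sum_integral_Ioo {D : Finset (LinInterval A B)} (hD : IsDivision (Set.Icc A B) D)
    {f : ℝ → ℝ} (hf : IntegrableOn f (Set.Icc A B)) :
    ∑ I ∈ D, ∫ x in Set.Ioo I.lo I.hi, f x = ∫ x in Set.Icc A B, f x := by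
  have hcov : (⋃ I ∈ D, Set.Ioo I.lo I.hi) =ᵐ[volume] Set.Icc A B := by
    rw [← isClosed_Icc.closure_eq, ← hD.2]
    exact Finset.eventuallyEq_iUnion _ fun I _ => Ioo_ae_eq_Icc
  rw [← setIntegral_congr_set hcov, integral_biUnion_finset D (fun _ _ => measurableSet_Ioo)]
  · exact fun I hI J hJ hIJ => (hD.1 hI hJ hIJ).disjoint_Ioo
  · exact fun I _ => hf.mono_set (Set.Ioo_subset_Icc_self.trans I.Icc_subset)

theorem densityKernel_eq (g : LinInterval A B → ℝ) (E : Set ℝ) (I : LinInterval A B) :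
    densityKernel g E I = g I * ((volume.restrict (Set.Ioo I.lo I.hi)).real E) /
      (volume.restrict (Set.Ioo I.lo I.hi)).real Set.univ := by
  rw [densityKernel, measureReal_restrict_apply' measurableSet_Ioo,
    measureReal_restrict_apply' measurableSet_Ioo, Set.univ_inter, Real.volume_real_Ioo_of_le
      I.lo_lt_hi.le, length]
  congr 2
  exact measureReal_congr (Filter.EventuallyEq.rfl.inter I.Ioo_ae_eq_toSet.symm)

theorem densityKernel_congr_set {E E' : Set ℝ} (h : E =ᵐ[volume] E') (g : LinInterval A B → ℝ) :
    densityKernel g E = densityKernel g E' := by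
  ext I
  have : (E ∩ I.toSet : Set ℝ) =ᵐ[volume] (E' ∩ I.toSet : Set ℝ) := h.inter Filter.EventuallyEq.rfl
  rw [densityKernel, densityKernel, measureReal_congr this]

/-- The error budget is `ε / 2` for replacing `g` by `N`, plus twice `ε / 8 + ε / 8`: the L¹
distance from `f` to a continuous `φ`, and the oscillation of `φ` on the cells. -/
theorem hasNormLimit_densityKernel (hAB : A < B) {g N : LinInterval A B → ℝ} {f : ℝ → ℝ}
    (hg : ∀ ε > 0, ∃ e > 0, ∀ D : Finset (LinInterval A B),
      (D : Set (LinInterval A B)).Pairwise NonOverlapping → (∀ I ∈ D, I.length < e) →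
      ∑ I ∈ D, |g I - N I| ≤ ε)
    (hf : IntegrableOn f (Set.Icc A B))
    (hN : ∀ I : LinInterval A B, N I = ∫ x in Set.Ioo I.lo I.hi, f x)
    {E : Set ℝ} (hE : MeasurableSet E) :
    HasNormLimit (Set.Icc A B) (densityKernel g E) (∫ x in Set.Icc A B, E.indicator f x) := by
  intro ε hε
  have hBA : 0 < B - A := sub_pos.2 hAB
  obtain ⟨e₁, he₁, h₁⟩ := hg (ε / 2) (by positivity)
  obtain ⟨φ, -, hφ, hφc, hφi⟩ := hf.exists_hasCompactSupport_integral_sub_le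
    (by positivity : 0 < ε / 8)
  have hunif := isCompact_Icc.uniformContinuousOn_of_continuous (hφc.continuousOn (s := Set.Icc A B))
  obtain ⟨e₂, he₂, h₂⟩ := Metric.uniformContinuousOn_iff.1 hunif (ε / (8 * (B - A)))
    (by positivity)
  refine ⟨min e₁ e₂, lt_min he₁ he₂, fun D hD hfine => ?_⟩
  have hK1 : ∀ I ∈ D, |densityKernel g E I - densityKernel N E I| ≤ |g I - N I| := by
    intro I _
    rw [densityKernel_eq, densityKernel_eq, ← sub_div, ← sub_mul, mul_div_assoc, abs_mul]
    refine mul_le_of_le_one_right (abs_nonneg _) ?_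
    rw [abs_of_nonneg (by positivity)]
    exact div_le_one_of_le₀ (measureReal_mono (Set.subset_univ E)) measureReal_nonneg
  have hfφ : IntegrableOn (fun x => |f x - φ x|) (Set.Icc A B) := (hf.sub hφi).abs
  have hK2 : ∀ I ∈ D, |densityKernel N E I - ∫ x in Set.Ioo I.lo I.hi, E.indicator f x| ≤
      2 * (∫ x in Set.Ioo I.lo I.hi, (|f x - φ x| + ε / (8 * (B - A)))) := by
    intro I hI
    have hsub : Set.Ioo I.lo I.hi ⊆ Set.Icc A B := Set.Ioo_subset_Icc_self.trans I.Icc_subset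
    rw [densityKernel_eq, hN]
    -- The constant subtracted on `I` is the value of `φ` at its left end-point.
    refine (abs_average_indicator_sub_le ?_ hE (hf.mono_set hsub) (φ I.lo)).trans ?_
    · rw [measureReal_restrict_apply' measurableSet_Ioo, Set.univ_inter,
        Real.volume_real_Ioo_of_le I.lo_lt_hi.le]
      exact I.length_pos.ne'
    · refine mul_le_mul_of_nonneg_left ?_ zero_le_two
      refine setIntegral_mono_on ?_ ?_ measurableSet_Ioo fun x hx => ?_
      · exact ((hf.mono_set hsub).sub (integrable_const _)).abs
      · exact (hfφ.mono_set hsub).add (integrable_const _)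
      · have hlen := (hfine I hI).trans_le (min_le_right _ _)
        rw [length] at hlen
        have := h₂ x (hsub hx) I.lo (I.Icc_subset ⟨le_rfl, I.lo_lt_hi.le⟩) (by
          rw [Real.dist_eq, abs_of_pos (sub_pos.2 hx.1)]
          linarith [hx.2])
        rw [Real.dist_eq] at this
        exact (abs_sub_le _ (φ x) _).trans (by linarith)
  have hc : IntegrableOn (fun _ : ℝ => ε / (8 * (B - A))) (Set.Icc A B) := integrableOn_const (by simp)
  have hS1 := (Finset.sum_le_sum hK1).trans
    (h₁ D hD.1 fun I hI => (hfine I hI).trans_le (min_le_left _ _))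
  have hS2 := Finset.sum_le_sum hK2
  have hfφc : IntegrableOn (fun x => |f x - φ x| + ε / (8 * (B - A))) (Set.Icc A B) := hfφ.add hc
  rw [← Finset.mul_sum, sum_integral_Ioo hD hfφc, integral_add hfφ hc] at hS2
  have hconst : ∫ _ in Set.Icc A B, ε / (8 * (B - A)) = ε / 8 := by
    rw [setIntegral_const, Real.volume_real_Icc_of_le hAB.le, smul_eq_mul]
    field_simp
  rw [hconst] at hS2
  simp only [Real.norm_eq_abs] at hφ
  rw [← sum_integral_Ioo hD (hf.indicator hE), ← Finset.sum_sub_distrib]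
  calc |∑ I ∈ D, (densityKernel g E I - ∫ x in Set.Ioo I.lo I.hi, E.indicator f x)|
      ≤ ∑ I ∈ D, |densityKernel g E I - ∫ x in Set.Ioo I.lo I.hi, E.indicator f x| :=
        Finset.abs_sum_le_sum_abs _ _
    _ ≤ ∑ I ∈ D, (|densityKernel g E I - densityKernel N E I| +
        |densityKernel N E I - ∫ x in Set.Ioo I.lo I.hi, E.indicator f x|) :=
        Finset.sum_le_sum fun I _ => abs_sub_le _ _ _
    _ ≤ ε := by
      rw [Finset.sum_add_distrib]
      linarith

theorem exists_hasNormLimit_densityKernel (hAB : A < B) {g N : LinInterval A B → ℝ} {L : ℝ}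
    (hL : HasNormLimit (Set.Icc A B) g L)
    (hN : ∀ I : LinInterval A B, HasNormLimit I.toSet g (N I))
    (hac : IntervalAbsolutelyContinuous N) {E : Set ℝ} (hE : NullMeasurableSet E volume) :
    ∃ L : ℝ, HasNormLimit (Set.Icc A B) (densityKernel g E) L := by
  -- A null set does not affect the kernel, so `E` may be taken Borel.
  obtain ⟨E', -, hE', hEE'⟩ := hE.exists_measurable_superset_ae_eq
  rw [← densityKernel_congr_set hEE' g]
  obtain ⟨F, hF⟩ := exists_forall_eq_sub hN
  have hFac := absolutelyContinuousOnInterval_of_forall_eq_sub hAB hac hF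
  refine ⟨_, hasNormLimit_densityKernel hAB (f := deriv F)
    (fun ε hε => hL.exists_sum_abs_sub_le hAB hN hε) ?_ ?_ hE'⟩
  · rw [← intervalIntegrable_iff_integrableOn_Icc_of_le hAB.le]
    exact hFac.intervalIntegrable_deriv
  · intro I
    have hsub : Set.uIcc I.lo I.hi ⊆ Set.uIcc A B := by
      rw [Set.uIcc_of_le hAB.le, Set.uIcc_of_le I.lo_lt_hi.le]
      exact I.Icc_subset
    rw [hF, ← (hFac.mono hsub).integral_deriv_eq_sub,
      intervalIntegral.integral_of_le I.lo_lt_hi.le, integral_Ioc_eq_integral_Ioo]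

/-! ### The Vitali-Hahn-Saks theorem. -/

section VitaliHahnSaks

open Filter Topology
open scoped symmDiff

variable {α : Type*} [MeasurableSpace α] {μ : Measure α}

/-- A sequence with summable successive distances converges to its limsup set `s`: a point of `u n ∆
s` must lie in a later successive difference, so the distance is at most a tail of the series.
Completeness is what allows Baire's theorem below. -/
instance MeasureTheory.MeasuredSets.instCompleteSpace : CompleteSpace (MeasuredSets μ) := by
  obtain ⟨b, hb, hsum⟩ := ENNReal.exists_pos_sum_of_countable' one_ne_zero ℕ
  refine EMetric.complete_of_convergent_controlled_sequences b hb fun u hu => ?_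
  let s : MeasuredSets μ := ⟨⋂ n, ⋃ k, (u (n + k) : Set α),
    MeasurableSet.iInter fun n => MeasurableSet.iUnion fun k => (u (n + k)).2⟩
  refine ⟨s, tendsto_iff_edist_tendsto_0.2 ?_⟩
  refine tendsto_of_tendsto_of_tendsto_of_le_of_le tendsto_const_nhds
    (ENNReal.tendsto_sum_nat_add b (hsum.trans ENNReal.one_lt_top).ne)
    (fun _ => zero_le) fun n => ?_
  have hsub : (u n : Set α) ∆ s ⊆ ⋃ k, (u (k + n) : Set α) ∆ (u (k + n + 1)) := by
    intro x hx
    by_contra hcon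
    simp only [Set.mem_iUnion, not_exists, Set.mem_symmDiff] at hcon
    have hiff : ∀ k, x ∈ (u (k + n) : Set α) ↔ x ∈ (u n : Set α) := by
      intro k
      induction k with
      | zero => simp
      | succ k ih =>
        have := hcon k
        rw [show k + 1 + n = k + n + 1 by omega]
        tauto
    have hs : x ∈ (s : Set α) ↔ x ∈ (u n : Set α) := by
      change x ∈ ⋂ n, ⋃ k, (u (n + k) : Set α) ↔ _
      simp only [Set.mem_iInter, Set.mem_iUnion]
      constructor
      · intro h
        obtain ⟨k, hk⟩ := h n
        exact (hiff k).1 (by rwa [add_comm])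
      · exact fun h m => ⟨n, (hiff m).2 h⟩
    rw [Set.mem_symmDiff] at hx
    tauto
  calc edist (u n) s = μ ((u n : Set α) ∆ s) := rfl
    _ ≤ ∑' k, μ ((u (k + n) : Set α) ∆ (u (k + n + 1))) :=
      (measure_mono hsub).trans (measure_iUnion_le _)
    _ ≤ ∑' k, b (k + n) := ENNReal.tsum_le_tsum fun k => (hu (k + n) _ _ le_rfl (by omega)).le

/-- A form of the Vitali-Hahn-Saks theorem: a setwise limit of additive set functions, each of
which is dominated by a multiple of a finite measure `μ`, is absolutely continuous with respect
to `μ`. -/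
theorem exists_forall_abs_limit_le [IsFiniteMeasure μ] {ν : ℕ → Set α → ℝ} {l : Set α → ℝ}
    {C : ℕ → ℝ}
    (hadd : ∀ n s t, MeasurableSet s → MeasurableSet t → Disjoint s t →
      ν n (s ∪ t) = ν n s + ν n t)
    (hC : ∀ n s, MeasurableSet s → |ν n s| ≤ C n * μ.real s)
    (hl : ∀ s, MeasurableSet s → Tendsto (fun n => ν n s) atTop (𝓝 (l s)))
    {ε : ℝ} (hε : 0 < ε) :
    ∃ δ > 0, ∀ s, MeasurableSet s → μ.real s < δ → |l s| ≤ ε := by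
  have hcont : ∀ n, Continuous fun s : MeasuredSets μ => ν n s := by
    intro n
    refine (LipschitzWith.of_dist_le_mul (K := (C n).toNNReal) fun s t => ?_).continuous
    have hsm : MeasurableSet (s : Set α) := s.2
    have htm : MeasurableSet (t : Set α) := t.2
    have hs : ν n s = ν n (s ∩ t) + ν n (s \ t) := by
      rw [← hadd n _ _ (hsm.inter htm) (hsm.diff htm) Set.disjoint_sdiff_inter.symm,
        Set.inter_union_sdiff]
    have ht : ν n t = ν n (s ∩ t) + ν n (t \ s) := by
      rw [Set.inter_comm, ← hadd n _ _ (htm.inter hsm) (htm.diff hsm)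
        Set.disjoint_sdiff_inter.symm, Set.inter_union_sdiff]
    have h1 := hC n _ (hsm.diff htm)
    have h2 := hC n _ (htm.diff hsm)
    have hdisj : Disjoint (s \ t : Set α) (t \ s) :=
      Set.disjoint_sdiff_left.mono_right Set.sdiff_subset
    rw [MeasuredSets.dist_def, Set.symmDiff_def, measureReal_union hdisj (htm.diff hsm),
      Real.dist_eq, hs, ht, add_sub_add_left_eq_sub]
    refine (abs_sub _ _).trans ((add_le_add h1 h2).trans ?_)
    rw [← mul_add]
    exact mul_le_mul_of_nonneg_right (Real.le_coe_toNNReal _) (by positivity)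
  -- Pointwise convergence makes these closed sets cover the space, so by Baire one of them contains
  -- a ball.
  let K : ℕ → Set (MeasuredSets μ) := fun k => ⋂ n, ⋂ (_ : k ≤ n), {s | |ν n s - ν k s| ≤ ε / 3}
  have hK : ∀ k, IsClosed (K k) := fun k => isClosed_iInter fun n => isClosed_iInter fun _ =>
    isClosed_le ((hcont n).sub (hcont k)).abs continuous_const
  have hU : ⋃ k, K k = Set.univ := by
    refine Set.eq_univ_of_forall fun s => Set.mem_iUnion.2 ?_
    obtain ⟨k, hk⟩ := Metric.cauchySeq_iff'.1 (hl s s.2).cauchySeq (ε / 3) (by positivity)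
    exact ⟨k, by simpa [K, Real.dist_eq] using fun n hn => (hk n hn).le⟩
  have : Nonempty (MeasuredSets μ) := ⟨⟨∅, MeasurableSet.empty⟩⟩
  obtain ⟨k, s₀, hs₀⟩ := nonempty_interior_of_iUnion_of_closed hK hU
  obtain ⟨r, hr, hball⟩ := Metric.mem_nhds_iff.1 (mem_interior_iff_mem_nhds.1 hs₀)
  have hmem : ∀ t, MeasurableSet t → μ.real (t ∆ s₀) < r → ∀ n ≥ k, |ν n t - ν k t| ≤ ε / 3 := by
    intro t ht hlt n hn
    let t' : MeasuredSets μ := ⟨t, ht⟩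
    have ht' : dist t' s₀ < r := hlt
    exact Set.mem_iInter₂.1 (hball (Metric.mem_ball.2 ht')) n hn
  have hs₀m : MeasurableSet (s₀ : Set α) := s₀.2
  -- The first bound keeps `s₀ ∪ s` and `s₀ \ s` in the ball; the second makes `|ν k s| ≤ ε / 3`. As
  -- `ν n s` is the difference of the values at these two sets, `|ν n s - ν k s| ≤ 2 * (ε / 3)`.
  refine ⟨min r (ε / 3 / (|C k| + 1)), by positivity, fun s hs hlt => ?_⟩
  have hk : |ν k s| ≤ ε / 3 := by
    have h1 := hlt.le.trans (min_le_right _ _)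
    rw [le_div_iff₀ (by positivity)] at h1
    have h2 : C k * μ.real s ≤ |C k| * μ.real s :=
      mul_le_mul_of_nonneg_right (le_abs_self _) measureReal_nonneg
    linarith [hC k s hs, measureReal_nonneg (μ := μ) (s := s)]
  have hn : ∀ n ≥ k, |ν n s| ≤ ε := by
    intro n hn
    have hunion : ∀ m, ν m (s₀ ∪ s) = ν m (s₀ \ s) + ν m s := by
      intro m
      rw [← hadd m _ _ (hs₀m.diff hs) hs Set.disjoint_sdiff_left, Set.sdiff_union_self]
    have h1 := hmem (s₀ ∪ s) (hs₀m.union hs) ((measureReal_mono (by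
      intro x; simp only [Set.mem_symmDiff, Set.mem_union]; tauto)).trans_lt
      (hlt.trans_le (min_le_left _ _))) n hn
    have h2 := hmem (s₀ \ s) (hs₀m.diff hs) ((measureReal_mono (by
      intro x; simp only [Set.mem_symmDiff, Set.mem_sdiff]; tauto)).trans_lt
      (hlt.trans_le (min_le_left _ _))) n hn
    rw [hunion, hunion] at h1
    rw [abs_le] at *
    constructor <;> linarith
  exact le_of_tendsto (hl s hs).abs (eventually_atTop.2 ⟨k, hn⟩)

end VitaliHahnSaks

/-! ### Necessity: density integrals over unions of intervals. -/

namespace LinInterval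

theorem toSet_eq_ite (I : LinInterval A B) : I.toSet =
    (if I.leftClosed then Set.Ici I.lo else Set.Ioi I.lo) ∩
      (if I.rightClosed then Set.Iic I.hi else Set.Iio I.hi) := by
  ext x
  cases hl : I.leftClosed <;> cases hr : I.rightClosed <;>
    simp [toSet, hl, hr, le_iff_lt_or_eq, @eq_comm _ x]

theorem measurableSet_toSet (I : LinInterval A B) : MeasurableSet I.toSet := by
  rw [toSet_eq_ite]
  refine MeasurableSet.inter ?_ ?_ <;> split_ifs <;> measurability

theorem volume_real_toSet (I : LinInterval A B) : volume.real I.toSet = I.length := by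
  rw [← measureReal_congr I.Ioo_ae_eq_toSet, Real.volume_real_Ioo_of_le I.lo_lt_hi.le, length]

end LinInterval

theorem IsISigma.measurableSet {R : Set ℝ} (hR : IsISigma A B R) : MeasurableSet R := by
  obtain ⟨T, rfl⟩ := hR
  exact T.measurableSet_biUnion fun I _ => I.measurableSet_toSet

theorem IsISigma.subset_Icc {R : Set ℝ} (hR : IsISigma A B R) : R ⊆ Set.Icc A B := by
  obtain ⟨T, rfl⟩ := hR
  exact Set.iUnion₂_subset fun I _ => I.toSet_subset_Icc.trans I.Icc_subset

theorem IsISigma.closure_ae_eq {R : Set ℝ} (hR : IsISigma A B R) : closure R =ᵐ[volume] R := by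
  obtain ⟨T, rfl⟩ := hR
  rw [closure_biUnion_toSet]
  exact Finset.eventuallyEq_iUnion _ fun I _ => Ioo_ae_eq_Icc.symm.trans I.Ioo_ae_eq_toSet

theorem densityKernel_of_subset_closure (g : LinInterval A B → ℝ) {R : Set ℝ}
    (hR : IsISigma A B R) {I : LinInterval A B} (hI : Set.Icc I.lo I.hi ⊆ closure R) :
    densityKernel g R I = g I := by
  rw [← densityKernel_congr_set hR.closure_ae_eq, densityKernel,
    Set.inter_eq_right.2 (I.toSet_subset_Icc.trans hI), I.volume_real_toSet, mul_div_assoc,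
    div_self I.length_pos.ne', mul_one]

theorem densityKernel_of_nonOverlapping (g : LinInterval A B → ℝ) {R : Set ℝ}
    {D : Finset (LinInterval A B)} (hD : IsDivision R D) (hR : IsISigma A B R)
    {I : LinInterval A B} (hI : ∀ J ∈ D, I.NonOverlapping J) : densityKernel g R I = 0 := by
  have hae : (⋃ J ∈ D, Set.Ioo J.lo J.hi) =ᵐ[volume] R := by
    refine Filter.EventuallyEq.trans ?_ hR.closure_ae_eq
    rw [← hD.2]
    exact Finset.eventuallyEq_iUnion _ fun I _ => Ioo_ae_eq_Icc
  have hdisj : (⋃ J ∈ D, Set.Ioo J.lo J.hi) ∩ Set.Ioo I.lo I.hi = ∅ := by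
    rw [← Set.disjoint_iff_inter_eq_empty, Set.disjoint_iUnion₂_left]
    exact fun J hJ => (hI J hJ).symm.disjoint_Ioo
  rw [← densityKernel_congr_set hae, densityKernel_eq,
    measureReal_restrict_apply' measurableSet_Ioo, hdisj]
  simp

/-- The density integral over a finite union `R` of intervals is the norm-limit over `R`. -/
theorem HasNormLimit.of_densityKernel (hAB : A < B) {g : LinInterval A B → ℝ} {R : Set ℝ}
    (hR : IsISigma A B R) {L : ℝ} (h : HasNormLimit (Set.Icc A B) (densityKernel g R) L) :
    HasNormLimit R g L := by
  classical
  intro ε hε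
  obtain ⟨e, he, h⟩ := h ε hε
  refine ⟨e, he, fun D hD hfine => ?_⟩
  -- The added intervals do not overlap `R`, so the density sum over `D ∪ D₂` is the `g`-sum over
  -- `D`.
  obtain ⟨D₂, hdisj, hdiv, hfine₂⟩ := exists_completion hAB hD.1 he
  have := h (D ∪ D₂) hdiv fun I hI => (Finset.mem_union.1 hI).elim (hfine I) (hfine₂ I)
  rw [Finset.sum_union hdisj,
    Finset.sum_congr rfl fun I hI => densityKernel_of_subset_closure g hR (hD.Icc_subset hI),
    Finset.sum_eq_zero (s := D₂) fun I hI => densityKernel_of_nonOverlapping g hD hR fun J hJ =>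
      hdiv.1 (Finset.mem_union_right _ hI) (Finset.mem_union_left _ hJ) fun h =>
        Finset.disjoint_right.1 hdisj hI (h ▸ hJ), add_zero] at this
  exact this

/-- Vitali-Hahn-Saks along one sequence of divisions `D n` of norm below `1 / (n + 1)`. Intersecting
with `[A, B]` defines the set functions on all measurable sets. -/
theorem exists_forall_abs_densityIntegral_le (hAB : A < B) {g : LinInterval A B → ℝ}
    {l : Set ℝ → ℝ} (hl : ∀ E, MeasurableSet E →
      HasNormLimit (Set.Icc A B) (densityKernel g (E ∩ Set.Icc A B)) (l E)) {ε : ℝ} (hε : 0 < ε) :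
    ∃ δ > 0, ∀ E, MeasurableSet E → volume.real (E ∩ Set.Icc A B) < δ → |l E| ≤ ε := by
  choose D hD hfine using fun n : ℕ =>
    exists_fine_division (isISigma_Icc hAB) (Nat.one_div_pos_of_nat (α := ℝ) (n := n))
  have := exists_forall_abs_limit_le (μ := volume.restrict (Set.Icc A B)) (l := l)
    (ν := fun n E => ∑ I ∈ D n, densityKernel g (E ∩ Set.Icc A B) I)
    (C := fun n => ∑ I ∈ D n, |g I| / I.length) ?_ ?_ ?_ hε
  · simpa only [measureReal_restrict_apply' measurableSet_Icc] using this
  · intro n s t hs ht hst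
    rw [← Finset.sum_add_distrib]
    refine Finset.sum_congr rfl fun I _ => ?_
    have : volume.real ((s ∪ t) ∩ Set.Icc A B ∩ I.toSet) =
        volume.real (s ∩ Set.Icc A B ∩ I.toSet) + volume.real (t ∩ Set.Icc A B ∩ I.toSet) := by
      rw [Set.union_inter_distrib_right, Set.union_inter_distrib_right]
      refine measureReal_union ?_ ((ht.inter measurableSet_Icc).inter I.measurableSet_toSet) ?_ ?_
      · exact hst.mono (fun x hx => hx.1.1) fun x hx => hx.1.1
      · exact measure_ne_top_of_subset (fun x hx => hx.1.2) measure_Icc_lt_top.ne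
      · exact measure_ne_top_of_subset (fun x hx => hx.1.2) measure_Icc_lt_top.ne
    rw [densityKernel, densityKernel, densityKernel, this]
    ring
  · intro n s hs
    rw [Finset.sum_mul]
    refine (Finset.abs_sum_le_sum_abs _ _).trans (Finset.sum_le_sum fun I _ => ?_)
    rw [densityKernel, abs_div, abs_mul, abs_of_pos I.length_pos,
      abs_of_nonneg measureReal_nonneg, mul_div_right_comm,
      measureReal_restrict_apply' measurableSet_Icc]
    refine mul_le_mul_of_nonneg_left (measureReal_mono Set.inter_subset_left ?_)
      (div_nonneg (abs_nonneg _) I.length_pos.le)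
    exact measure_ne_top_of_subset Set.inter_subset_right measure_Icc_lt_top.ne
  · intro s hs
    rw [Metric.tendsto_atTop]
    intro ε hε
    obtain ⟨e, he, h⟩ := hl s hs (ε / 2) (by positivity)
    obtain ⟨k, hk⟩ := exists_nat_one_div_lt he
    refine ⟨k, fun n hn => ?_⟩
    rw [Real.dist_eq]
    refine (h (D n) (hD n) fun I hI => (hfine n I hI).trans_le ?_).trans_lt (by linarith)
    exact (Nat.one_div_le_one_div hn).trans hk.le

theorem intervalAbsolutelyContinuous_of_hasNormLimit (hAB : A < B) {g N : LinInterval A B → ℝ}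
    (h : ∀ E, MeasurableSet E → E ⊆ Set.Icc A B →
      ∃ L, HasNormLimit (Set.Icc A B) (densityKernel g E) L)
    (hN : ∀ I : LinInterval A B, HasNormLimit I.toSet g (N I)) :
    IntervalAbsolutelyContinuous N := by
  intro ε hε
  have h' : ∀ E : Set ℝ, ∃ L, MeasurableSet E →
      HasNormLimit (Set.Icc A B) (densityKernel g (E ∩ Set.Icc A B)) L := by
    intro E
    by_cases hE : MeasurableSet E
    · obtain ⟨L, hL⟩ := h _ (hE.inter measurableSet_Icc) Set.inter_subset_right
      exact ⟨L, fun _ => hL⟩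
    · exact ⟨0, fun hE' => absurd hE' hE⟩
  choose l hl using h'
  obtain ⟨δ, hδ, H⟩ := exists_forall_abs_densityIntegral_le hAB hl (by positivity : 0 < ε / 2)
  refine ⟨δ, hδ, fun T hT hlen => ?_⟩
  have hR : IsISigma A B (⋃ I ∈ T, I.toSet) := ⟨T, rfl⟩
  have hL := hl _ hR.measurableSet
  have hle := H _ hR.measurableSet
  rw [Set.inter_eq_left.2 hR.subset_Icc] at hL hle
  -- The sum of `N` over `T` is the norm-limit over the union of `T`, hence the density integral of
  -- that union.
  rw [← (hL.of_densityKernel hAB hR).eq_sum (isDivision_biUnion hT) fun I _ => hN I]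
  refine (hle ?_).trans_lt (by linarith)
  refine (measureReal_biUnion_finset_le _ _).trans_lt ?_
  simpa only [volume_real_toSet] using hlen

theorem mainTheorem10 {A B : ℝ} (hAB : A < B) (g : LinInterval A B → ℝ) :
    (∀ E : Set ℝ, E ⊆ Set.Icc A B → NullMeasurableSet E volume →
      ∃ L : ℝ, upperDensityIntegral (G1 A B) E g = (L : EReal) ∧
        lowerDensityIntegral (G1 A B) E g = (L : EReal)) ↔
    ((∀ R : Set ℝ, IsISigma A B R → NormLimitExists (G1 A B) R g) ∧
      IntervalAbsolutelyContinuous (fun I : LinInterval A B => normLimit (G1 A B) I.toSet g)) := by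
  have hW := isISigma_Icc hAB
  constructor
  · intro h
    have h' : ∀ E, MeasurableSet E → E ⊆ Set.Icc A B →
        ∃ L, HasNormLimit (Set.Icc A B) (densityKernel g E) L := fun E hE hEW =>
      (h E hEW hE.nullMeasurableSet).imp fun L hL => (normLimits_eq_iff hW _ L).1 hL
    have hex : ∀ R : Set ℝ, IsISigma A B R → NormLimitExists (G1 A B) R g := by
      intro R hR
      obtain ⟨L, hL⟩ := h' R hR.measurableSet hR.subset_Icc
      exact ⟨L, (normLimits_eq_iff hR g L).2 (hL.of_densityKernel hAB hR)⟩
    exact ⟨hex, intervalAbsolutelyContinuous_of_hasNormLimit hAB h' fun I =>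
      (hex _ I.isISigma_toSet).hasNormLimit I.isISigma_toSet⟩
  · rintro ⟨hex, hac⟩ E - hE
    obtain ⟨L, hL⟩ := exists_hasNormLimit_densityKernel hAB ((hex _ hW).hasNormLimit hW)
      (fun I => (hex _ I.isISigma_toSet).hasNormLimit I.isISigma_toSet) hac hE
    exact ⟨L, (normLimits_eq_iff hW _ L).2 hL⟩
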